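/- Let $H$ be the upper half-plane, let $\mathcal M=\bigoplus_{k\ge 0}\mathcal M_k$ be the graded algebra of modular forms of all weights, where $\mathcal M_k$ is the space of modular forms of weight $k$ for $\Gamma(N)$ with $N\ge 1$ arbitrary, and let $G^+(\mathbb Q)=\mathrm{GL}^+(2,\mathbb Q)$ act on the right of $\mathcal M_k$ by $$(f|_k\alpha)(z)=\det(\alpha)^{k/2}f(\alpha\cdot z)(cz+d)^{-k},\qquad \alpha=\begin{pmatrix}a&b\\c&d\end{pmatrix}.$$ Let $\mathcal A_{G^+(\mathbb Q)}=\mathcal M\rtimes G^+(\mathbb Q)$ be the crossed product algebra of finite sums of symbols $f\,U_\gamma^*$ ($f\in\mathcal M$, $\gamma\in G^+(\mathbb Q)$) with product $fU_\alpha^*\cdot gU_\beta^*=(f\cdot g|\alpha)\,U_{\beta\alpha}^*$, in which $\mathcal M$ is embedded by $f\mapsto f\,U_1^*$. Let $\eta$ be the Dedekind eta function, $\Delta=(2\pi)^{12}\eta^{24}$, and let $X$ and $\delta_1$ be the linear operators on $\mathcal A_{G^+(\mathbb Q)}$ given by $X(fU_\gamma^*)=X(f)U_\gamma^*$ and $\delta_1(fU_\gamma^*)=\mu_\gamma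 f\,U_\gamma^*$, where $$X(f)=\frac1{2\pi i}\frac{df}{dz}-\frac{1}{12\pi i}\Big(\frac{d}{dz}\log\Delta\Big)\frac k2 f\in\mathcal M_{k+2}\quad(f\in\mathcal M_k),\qquad \mu_\gamma=\frac1{12\pi i}\frac d{dz}\log\frac{\Delta|_{12}\gamma}{\Delta}\in\mathcal M_2 .$$ Put $\delta_2=[X,\delta_1]=X\delta_1-\delta_1X$ and $\delta_2'=\delta_2-\tfrac12\delta_1^2$. Let $$Z(z)=\frac{2\pi i}{6}\int_{i\infty}^z\eta^4\,dz ,$$ where the integral, taken along the vertical half-line from $i\infty$ to $z$, converges absolutely and satisfies $dZ=\frac{2\pi i}{6}\eta^4\,dz$, and let $\{y;x\}=\frac{d^2}{dx^2}\log\frac{dy}{dx}-\frac12\big(\frac{d}{dx}\log\frac{dy}{dx}\big)^2$ be the Schwarzian derivative. Then the function $$\omega_4=(2\pi i)^{-2}\{Z;z\}=-\frac{E_4}{72},$$ where $E_4=1+240\sum_{n\ge1}n^3\frac{q^n}{1-q^n}$, $q=e^{2\pi i z}$, is the normalized Eisenstein series of weight $4$ and level $1$, belongs to $\mathcal M_4$;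 the operator $\delta_2'$ is a derivation of $\mathcal A_{G^+(\mathbb Q)}$; and it is inner, implemented by $\omega_4$: $$\delta_2'(a)=[a,\omega_4]=a\,\omega_4-\omega_4\,a\qquad\text{for all }a\in\mathcal A_{G^+(\mathbb Q)} .$$ -/

import Mathlib

open UpperHalfPlane hiding I
open Complex MatrixGroups CongruenceSubgroup Matrix.SpecialLinearGroup
open scoped ModularForm Manifold Real DirectSum MulOpposite

noncomputable section

namespace ModHecke

/-- The group `G⁺(ℚ) = GL⁺(2, ℚ)`. -/
abbrev GQ : Type := GL(2, ℚ)⁺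

/-- The inclusion `GL⁺(2, ℚ) → GL(2, ℝ)`. -/
def toGLReal : GQ →* GL (Fin 2) ℝ :=
  (Matrix.GeneralLinearGroup.map (Rat.castHom ℝ)).comp (Matrix.GLPos (Fin 2) ℚ).subtype

/-- The slash operator `(f|ₖ α)(z) = det(α)^{k/2} f(α·z) j(α,z)^{-k}`, for `α ∈ GL⁺(2,ℚ)`. -/
def slash (k : ℕ) (α : GQ) (f : ℍ → ℂ) (z : ℍ) : ℂ :=
  (((toGLReal α).det.val ^ ((k : ℝ) / 2) : ℝ) : ℂ) * f (toGLReal α • z) /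
    denom (toGLReal α) z ^ k

lemma det_pos (α : GQ) : 0 < (toGLReal α).det.val := by
  have h := α.2
  rw [Matrix.mem_glpos] at h
  have : (toGLReal α).det.val = (((α : GL (Fin 2) ℚ).det.val : ℚ) : ℝ) := by
    simp [toGLReal, Matrix.det_fin_two]
  rw [this]; exact_mod_cast h

lemma slash_eq (k : ℕ) (α : GQ) (f : ℍ → ℂ) :
    slash k α f = (((toGLReal α).det.val ^ (1 - (k : ℝ) / 2) : ℝ) : ℂ) •
      (f ∣[(k : ℤ)] toGLReal α) := by
  have hd := det_pos α
  ext z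
  have hσ : ∀ x, σ (toGLReal α) x = x := by
    intro x; simp only [σ, hd, if_true]; rfl
  simp only [slash, Pi.smul_apply, smul_eq_mul, ModularForm.slash_apply, hσ, abs_of_pos hd]
  have h : ((toGLReal α).det.val ^ ((k : ℝ) / 2) : ℝ) =
      (toGLReal α).det.val ^ (1 - (k : ℝ) / 2) * (toGLReal α).det.val ^ ((k : ℤ) - 1) := by
    rw [← Real.rpow_intCast, ← Real.rpow_add hd]
    congr 1; push_cast; ring
  rw [h]
  push_cast
  rw [zpow_neg, zpow_natCast]
  ring

lemma slash_one (k : ℕ) (f : ℍ → ℂ) : slash k 1 f = f := by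
  simp [slash_eq]

lemma slash_smul (k : ℕ) (α : GQ) (c : ℂ) (f : ℍ → ℂ) :
    slash k α (c • f) = c • slash k α f := by
  ext z; simp only [slash, Pi.smul_apply, smul_eq_mul]; ring

lemma slash_mul (k : ℕ) (α β : GQ) (f : ℍ → ℂ) :
    slash k (α * β) f = slash k β (slash k α f) := by
  have h : slash k β (slash k α f) = (((toGLReal α).det.val ^ (1 - (k : ℝ) / 2) : ℝ) : ℂ) •
      slash k β (f ∣[(k : ℤ)] toGLReal α) := by
    rw [slash_eq k α, slash_smul]
  rw [h, slash_eq, slash_eq, map_mul, SlashAction.slash_mul, smul_smul]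
  congr 1
  rw [map_mul, Units.val_mul, Real.mul_rpow (det_pos α).le (det_pos β).le]
  push_cast
  ring

lemma slash_add (k : ℕ) (α : GQ) (f g : ℍ → ℂ) :
    slash k α (f + g) = slash k α f + slash k α g := by
  simp [slash_eq]

lemma slash_mul_slash (k l : ℕ) (α : GQ) (f g : ℍ → ℂ) :
    slash (k + l) α (f * g) = slash k α f * slash l α g := by
  ext z
  simp only [slash, Pi.mul_apply]
  have : ((toGLReal α).det.val ^ (((k + l : ℕ) : ℝ) / 2) : ℝ) =
    (toGLReal α).det.val ^ ((k : ℝ) / 2) * (toGLReal α).det.val ^ ((l : ℝ) / 2) := by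
    rw [← Real.rpow_add (det_pos α)]; congr 1; push_cast; ring
  rw [this, pow_add]
  push_cast
  rw [mul_div_mul_comm, ← mul_div_mul_comm]
  ring

/-- `f` is a modular form of weight `k` for `Γ(N)`, for some level `N ≥ 1`. -/
def IsModular (k : ℕ) (f : ℍ → ℂ) : Prop :=
  ∃ N : ℕ, N ≠ 0 ∧ ∃ F : ModularForm (Γ(N) : Subgroup (GL (Fin 2) ℝ)) (k : ℤ), ⇑F = f

lemma isModular_iff (k : ℕ) (f : ℍ → ℂ) :
    IsModular k f ↔ MDiff f ∧ (∃ N : ℕ, N ≠ 0 ∧ ∀ γ ∈ Γ(N), f ∣[(k : ℤ)] γ = f) ∧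
      ∀ γ : SL(2, ℤ), IsBoundedAtImInfty (f ∣[(k : ℤ)] γ) := by
  constructor
  · rintro ⟨N, hN, F, rfl⟩
    have : NeZero N := ⟨hN⟩
    refine ⟨F.holo', ⟨N, hN, fun γ hγ ↦ ?_⟩, fun γ ↦ ?_⟩
    · exact F.slash_action_eq' _ ⟨γ, hγ, rfl⟩
    · refine F.bdd_at_cusps' (c := mapGL ℝ γ • OnePoint.infty) ?_ _ rfl
      rw [Subgroup.IsArithmetic.isCusp_iff_isCusp_SL2Z, isCusp_SL2Z_iff']
      exact ⟨γ, rfl⟩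
  · rintro ⟨h1, ⟨N, hN, h2⟩, h3⟩
    have : NeZero N := ⟨hN⟩
    refine ⟨N, hN, ⟨⟨f, ?_⟩, h1, ?_⟩, rfl⟩
    · rintro _ ⟨γ, hγ, rfl⟩
      exact h2 γ hγ
    · intro c hc
      rw [Subgroup.IsArithmetic.isCusp_iff_isCusp_SL2Z] at hc
      rw [OnePoint.isBoundedAt_iff_forall_SL2Z hc]
      exact fun γ _ ↦ h3 γ

lemma Gamma_anti {M N : ℕ} (h : M ∣ N) : Γ(N) ≤ Γ(M) := by
  intro γ hγ
  rw [Gamma_mem] at hγ ⊢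
  have key : ∀ a b : ℤ, (a : ZMod N) = b → (a : ZMod M) = b := by
    intro a b hab
    rw [ZMod.intCast_eq_intCast_iff_dvd_sub] at hab ⊢
    exact (Int.natCast_dvd_natCast.mpr h).trans hab
  obtain ⟨h1, h2, h3, h4⟩ := hγ
  exact ⟨by simpa using key _ 1 (by simpa using h1), by simpa using key _ 0 (by simpa using h2),
    by simpa using key _ 0 (by simpa using h3), by simpa using key _ 1 (by simpa using h4)⟩

/-- The space `𝓜ₖ` of modular forms of weight `k` of arbitrary level. -/
def M (k : ℕ) : Submodule ℂ (ℍ → ℂ) where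
  carrier := {f | IsModular k f}
  zero_mem' := ⟨1, one_ne_zero, 0, rfl⟩
  add_mem' := by
    intro f g hf hg
    simp only [Set.mem_ofPred_eq, isModular_iff] at hf hg ⊢
    obtain ⟨f1, ⟨N, hN, f2⟩, f3⟩ := hf
    obtain ⟨g1, ⟨N', hN', g2⟩, g3⟩ := hg
    refine ⟨f1.add g1, ⟨N * N', mul_ne_zero hN hN', fun γ hγ ↦ ?_⟩, fun γ ↦ ?_⟩
    · rw [SlashAction.add_slash, f2 γ (Gamma_anti (dvd_mul_right _ _) hγ),
        g2 γ (Gamma_anti (dvd_mul_left _ _) hγ)]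
    · rw [SlashAction.add_slash]
      exact (f3 γ).add (g3 γ)
  smul_mem' := by
    rintro c _ ⟨N, hN, F, rfl⟩
    exact ⟨N, hN, c • F, rfl⟩

lemma mem_M {k : ℕ} {f : ℍ → ℂ} : f ∈ M k ↔ IsModular k f := Iff.rfl

instance : SetLike.GradedMonoid M where
  one_mem := by
    refine ⟨1, one_ne_zero, ModularForm.const 1, rfl⟩
  mul_mem := by
    intro i j f g hf hg
    simp only [mem_M, isModular_iff] at hf hg ⊢
    obtain ⟨f1, ⟨N, hN, f2⟩, f3⟩ := hf
    obtain ⟨g1, ⟨N', hN', g2⟩, g3⟩ := hg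
    refine ⟨f1.mul g1, ⟨N * N', mul_ne_zero hN hN', fun γ hγ ↦ ?_⟩, fun γ ↦ ?_⟩
    · push_cast
      rw [ModularForm.mul_slash_SL2, f2 γ (Gamma_anti (dvd_mul_right _ _) hγ),
        g2 γ (Gamma_anti (dvd_mul_left _ _) hγ)]
    · push_cast
      rw [ModularForm.mul_slash_SL2]
      exact (f3 γ).mul (g3 γ)

lemma map_mapGL' (γ : SL(2, ℤ)) :
    Matrix.GeneralLinearGroup.map (Rat.castHom ℝ) (mapGL ℚ γ) = mapGL ℝ γ := by
  ext i j
  simp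

lemma isCusp_smul (α : GQ) (γ : SL(2, ℤ)) :
    IsCusp ((toGLReal α * mapGL ℝ γ) • OnePoint.infty) 𝒮ℒ := by
  rw [isCusp_SL2Z_iff]
  refine ⟨((α : GL (Fin 2) ℚ) * mapGL ℚ γ) • OnePoint.infty, ?_⟩
  rw [← Rat.coe_castHom, OnePoint.map_smul, OnePoint.map_infty, map_mul, map_mapGL']
  rfl

lemma slash_mem {k : ℕ} (α : GQ) {f : ℍ → ℂ} (hf : f ∈ M k) : slash k α f ∈ M k := by
  rw [slash_eq]
  refine (M k).smul_mem _ ?_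
  rw [mem_M] at hf
  obtain ⟨N, hN, F, rfl⟩ := hf
  have : NeZero N := ⟨hN⟩
  rw [mem_M, isModular_iff]
  refine ⟨F.holo'.slash _ _, ?_, fun γ ↦ ?_⟩
  · obtain ⟨N', hN', h⟩ := exists_Gamma_le_conj (α : GL (Fin 2) ℚ) N
    refine ⟨N', hN', fun γ hγ ↦ ?_⟩
    obtain ⟨δ, hδ, hδ'⟩ := h γ hγ
    have e : toGLReal α * mapGL ℝ γ = mapGL ℝ δ * toGLReal α := by
      have h' := congr_arg (Matrix.GeneralLinearGroup.map (Rat.castHom ℝ)) hδ'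
      rw [map_mul, map_mul, map_inv, map_mapGL', map_mapGL'] at h'
      exact (eq_mul_inv_iff_mul_eq.mp h').symm
    rw [ModularForm.SL_slash, ← SlashAction.slash_mul]
    erw [e]
    rw [SlashAction.slash_mul]
    congr 1
    exact F.slash_action_eq' _ ⟨δ, hδ, rfl⟩
  · rw [ModularForm.SL_slash, ← SlashAction.slash_mul]
    refine F.bdd_at_cusps' (c := (toGLReal α * mapGL ℝ γ) • OnePoint.infty) ?_ _ rfl
    rw [Subgroup.IsArithmetic.isCusp_iff_isCusp_SL2Z]
    exact isCusp_smul α γ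


/-- Logarithmic derivative of a function on the upper half-plane. -/
def logD (F : ℍ → ℂ) (z : ℍ) : ℂ := logDeriv (F ∘ ofComplex) z

/-- The Ramanujan operator `X` on forms of weight `k`:
`X f = (2πi)⁻¹ f' - (12πi)⁻¹ (log Δ)' · (k/2) f`.
The factor `(2π)¹²` in the usual normalisation of `Δ` drops out of `(log Δ)'`. -/
def Xfun (k : ℕ) (f : ℍ → ℂ) (z : ℍ) : ℂ :=
  (2 * π * I)⁻¹ * deriv (f ∘ ofComplex) z -
    (12 * π * I)⁻¹ * logD ModularForm.discriminant z * ((k : ℂ) / 2 * f z)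

/-- `μ_γ = (12πi)⁻¹ d/dz log (Δ|γ / Δ)`. -/
def muFun (γ : GQ) (z : ℍ) : ℂ :=
  (12 * π * I)⁻¹ *
    logD (fun w ↦ slash 12 γ ModularForm.discriminant w / ModularForm.discriminant w) z

open Derivative EisensteinSeries

lemma logD_eq (F : ℍ → ℂ) (z : ℍ) : logD F z = 2 * π * I * D F z / F z := by
  have : (2 * π * I : ℂ) ≠ 0 := Complex.two_pi_I_ne_zero
  simp only [logD, logDeriv_apply, normalizedDerivOfComplex, Function.comp_apply, ofComplex_apply]
  field_simp

lemma mdiff_disc : MDiff ModularForm.discriminant := CuspForm.discriminant.holo'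

lemma logD_disc (z : ℍ) : logD ModularForm.discriminant z = 2 * π * I * E2 z := by
  have h : ModularForm.discriminant ∘ ofComplex =ᶠ[nhds (z : ℂ)] fun w ↦ ModularForm.eta w ^ 24 := by
    filter_upwards [isOpen_upperHalfPlaneSet.mem_nhds z.im_pos] with w hw
    simp [ModularForm.discriminant, ofComplex_apply_of_im_pos hw]
  have h2 : logD ModularForm.discriminant z = logDeriv (fun w ↦ ModularForm.eta w ^ 24) z := by
    simp only [logD, logDeriv_apply, h.deriv_eq, h.eq_of_nhds]
  rw [h2, logDeriv_fun_pow (ModularForm.differentiableAt_eta_of_mem_upperHalfPlaneSet z.2),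
    ModularForm.logDeriv_eta_eq_E2]
  push_cast; ring

lemma Xfun_eq (k : ℕ) (f : ℍ → ℂ) : Xfun k f = serreDerivative ((k : ℤ) : ℂ) f := by
  ext z
  have : (π : ℂ) ≠ 0 := by exact_mod_cast Real.pi_ne_zero
  simp only [Xfun, logD_disc, serreDerivative_apply, normalizedDerivOfComplex]
  push_cast
  field_simp

lemma isBounded_D {f : ℍ → ℂ} (hf : MDiff f) (hb : IsBoundedAtImInfty f) :
    IsBoundedAtImInfty (D f) := by
  rw [isBoundedAtImInfty_iff] at hb ⊢
  obtain ⟨C, A, h⟩ := hb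
  refine ⟨‖(2 * π * I : ℂ)⁻¹‖ * (C / (1 / 2)), max A 0 + 1, fun z hz ↦ ?_⟩
  rw [normalizedDerivOfComplex, norm_mul]
  have him : ∀ w ∈ Metric.closedBall (z : ℂ) (1 / 2), max A 0 < w.im := by
    intro w hw
    have h1 : |(w - z).im| ≤ 1 / 2 :=
      (Complex.abs_im_le_norm _).trans (by simpa [dist_eq_norm] using hw)
    have h2 := (abs_le.mp h1).1
    simp only [sub_im, coe_im] at h2
    linarith
  gcongr
  refine Complex.norm_deriv_le_of_forall_mem_sphere_norm_le (by norm_num) ?_ ?_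
  · refine DifferentiableOn.diffContOnCl ?_
    rw [closure_ball _ (by norm_num)]
    exact (UpperHalfPlane.mdifferentiable_iff.mp hf).mono
      fun w hw ↦ (le_max_right A 0).trans_lt (him w hw)
  · intro w hw
    have hw' := him w (Metric.sphere_subset_closedBall hw)
    have hpos : 0 < w.im := (le_max_right A 0).trans_lt hw'
    rw [Function.comp_apply, ofComplex_apply_of_im_pos hpos]
    exact h _ ((le_max_left A 0).trans hw'.le)

lemma Xfun_mem {k : ℕ} {f : ℍ → ℂ} (hf : f ∈ M k) : Xfun k f ∈ M (k + 2) := by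
  rw [mem_M, isModular_iff] at hf ⊢
  obtain ⟨f1, ⟨N, hN, f2⟩, f3⟩ := hf
  rw [Xfun_eq]
  push_cast
  refine ⟨serreDerivative_mdifferentiable _ f1, ⟨N, hN, fun γ hγ ↦ ?_⟩, fun γ ↦ ?_⟩
  · exact_mod_cast serreDerivative_slash_invariant f1 (f2 γ hγ)
  · have h1 := serreDerivative_slash_equivariant (k := k) f1 (γ := γ)
    push_cast at h1
    rw [h1]
    have h2 : MDiff (f ∣[(k : ℤ)] γ) := f1.slash _ _
    have h3 := (isBounded_D h2 (f3 γ)).sub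
      ((isBoundedAtImInfty_E2.mul (f3 γ)).const_mul_left ((k : ℂ) * 12⁻¹))
    refine h3.congr_left fun z ↦ ?_
    simp [serreDerivative_apply, mul_assoc]


/-- The cocycle `μ` for real matrices. -/
def muAux (g : GL (Fin 2) ℝ) (z : ℍ) : ℂ :=
  (12 * π * I)⁻¹ * (logD (ModularForm.discriminant ∣[(12 : ℤ)] g) z -
    logD ModularForm.discriminant z)

lemma slash_ne_zero {F : ℍ → ℂ} (hF : ∀ z, F z ≠ 0) (k : ℤ) {g : GL (Fin 2) ℝ}
    (hg : 0 < g.det.val) (z : ℍ) : (F ∣[k] g) z ≠ 0 := by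
  have hσ : ∀ x, σ g x = x := by
    intro x; simp only [σ, hg, if_true]; rfl
  rw [ModularForm.slash_apply, hσ, abs_of_pos hg]
  exact mul_ne_zero (mul_ne_zero (hF _) (zpow_ne_zero _ (by exact_mod_cast hg.ne')))
    (zpow_ne_zero _ (denom_ne_zero g z))

lemma muFun_eq (α : GQ) : muFun α = muAux (toGLReal α) := by
  ext z
  have hd := det_pos α
  set c : ℂ := (((toGLReal α).det.val ^ (1 - ((12 : ℕ) : ℝ) / 2) : ℝ) : ℂ) with hc
  have hc0 : c ≠ 0 := by
    rw [hc]; exact_mod_cast (Real.rpow_pos_of_pos hd _).ne'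
  set F := ModularForm.discriminant ∣[(12 : ℤ)] toGLReal α with hF
  have hFd : MDiff F := mdiff_disc.slash _ _
  have e : (fun w ↦ slash 12 α ModularForm.discriminant w / ModularForm.discriminant w) ∘ ofComplex
      = fun w ↦ (c * (F ∘ ofComplex) w) / (ModularForm.discriminant ∘ ofComplex) w := by
    ext w
    simp only [Function.comp_apply, slash_eq, Pi.smul_apply, smul_eq_mul]
    rfl
  rw [muFun, muAux, logD, e]
  have hFz : (F ∘ ofComplex) (z : ℂ) ≠ 0 := by
    simpa using slash_ne_zero ModularForm.discriminant_ne_zero 12 hd z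
  have hDz : (ModularForm.discriminant ∘ ofComplex) (z : ℂ) ≠ 0 := by
    simpa using ModularForm.discriminant_ne_zero z
  have d1 := UpperHalfPlane.mdifferentiableAt_iff.mp (hFd z)
  have d2 := UpperHalfPlane.mdifferentiableAt_iff.mp (mdiff_disc z)
  rw [logDeriv_div (f := fun w ↦ c * (F ∘ ofComplex) w) _ (mul_ne_zero hc0 hFz) hDz
    (d1.const_mul c) d2, logDeriv_const_mul _ _ hc0]
  rfl

lemma logD_slash {k : ℤ} {F : ℍ → ℂ} (hF : MDiff F) (h0 : ∀ z, F z ≠ 0) {g : GL (Fin 2) ℝ}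
    (hg : 0 < g.det.val) (z : ℍ) :
    logD (F ∣[k] g) z = (logD F ∣[(2 : ℤ)] g) z - k * (g 1 0 / denom g z) := by
  have h := congrFun (normalizedDerivOfComplex_slash (k := k) hF (g := g) hg) z
  have hσ : ∀ x, σ g x = x := by
    intro x; simp only [σ, hg, if_true]; rfl
  have hn := denom_ne_zero g z
  have hd : (g.det.val : ℂ) ≠ 0 := by exact_mod_cast hg.ne'
  have hd' : g.val.det = g.det.val := rfl
  rw [hd'] at h
  have hpi : (π : ℂ) ≠ 0 := by exact_mod_cast Real.pi_ne_zero
  have h1 := h0 (g • z)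
  rw [logD_eq, h]
  simp only [ModularForm.slash_apply, hσ, abs_of_pos hg, logD_eq]
  rw [show k + 2 - 1 = (k - 1) + 2 by ring, show -(k + 2) = -k + -2 by ring,
    zpow_add₀ hd, zpow_add₀ hn]
  have hz1 := zpow_ne_zero (k - 1) hd
  have hz2 := zpow_ne_zero (-k) hn
  generalize ((g.det.val : ℂ)) ^ (k - 1) = u at *
  generalize denom g z ^ (-k) = v at *
  rw [show (2 : ℤ) - 1 = 1 by norm_num, zpow_one, show (-2 : ℤ) = -((2 : ℕ) : ℤ) by norm_num,
    zpow_neg, zpow_natCast, show (2 : ℤ) = ((2 : ℕ) : ℤ) by norm_num, zpow_natCast]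
  field_simp

lemma muAux_mul {g h : GL (Fin 2) ℝ} (hg : 0 < g.det.val) (hh : 0 < h.det.val) :
    muAux (g * h) = muAux g ∣[(2 : ℤ)] h + muAux h := by
  ext z
  have hσ : ∀ x, σ h x = x := by
    intro x; simp only [σ, hh, if_true]; rfl
  have hF : MDiff (ModularForm.discriminant ∣[(12 : ℤ)] g) := mdiff_disc.slash _ _
  have e1 := logD_slash (k := 12) hF (slash_ne_zero ModularForm.discriminant_ne_zero 12 hg) hh z
  have e2 := logD_slash (k := 12) mdiff_disc ModularForm.discriminant_ne_zero hh z
  simp only [Pi.add_apply, muAux, SlashAction.slash_mul, e1, e2]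
  simp only [ModularForm.slash_apply, hσ, muAux]
  ring

lemma disc_slash (γ : SL(2, ℤ)) :
    ModularForm.discriminant ∣[(12 : ℤ)] (mapGL ℝ γ) = ModularForm.discriminant :=
  CuspForm.discriminant.slash_action_eq' _ ⟨γ, rfl⟩

lemma muAux_SL_mul (γ : SL(2, ℤ)) (g : GL (Fin 2) ℝ) : muAux (mapGL ℝ γ * g) = muAux g := by
  ext z
  simp only [muAux, SlashAction.slash_mul, disc_slash]

lemma muAux_SL (γ : SL(2, ℤ)) : muAux (mapGL ℝ γ) = 0 := by
  ext z
  simp [muAux, disc_slash]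

lemma det_mapGL_pos (γ : SL(2, ℤ)) : 0 < (mapGL ℝ γ).det.val := by
  simp

lemma muAux_slash_SL {g : GL (Fin 2) ℝ} (hg : 0 < g.det.val) (γ : SL(2, ℤ)) :
    muAux g ∣[(2 : ℤ)] γ = muAux (g * mapGL ℝ γ) := by
  rw [muAux_mul hg (det_mapGL_pos γ), muAux_SL, add_zero]
  rfl

lemma mdiff_muAux {g : GL (Fin 2) ℝ} (hg : 0 < g.det.val) : MDiff (muAux g) := by
  have key : ∀ F : ℍ → ℂ, MDiff F → (∀ z, F z ≠ 0) → MDiff (logD F) := by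
    intro F hF h0
    have hD := normalizedDerivOfComplex_mdifferentiable hF
    rw [UpperHalfPlane.mdifferentiable_iff] at hF hD ⊢
    refine ((hD.const_mul (2 * π * I)).div hF fun w _ ↦ h0 _).congr fun w hw ↦ ?_
    simp [logD_eq]
  have h1 := key _ (mdiff_disc.slash 12 g) (slash_ne_zero ModularForm.discriminant_ne_zero 12 hg)
  have h2 := key _ mdiff_disc ModularForm.discriminant_ne_zero
  exact (mdifferentiable_const (c := ((12 * π * I)⁻¹ : ℂ))).mul (h1.sub h2)

lemma isBounded_muAux {g : GL (Fin 2) ℝ} (hg : 0 < g.det.val)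
    (hc : IsCusp (g • OnePoint.infty) 𝒮ℒ) : IsBoundedAtImInfty (muAux g) := by
  obtain ⟨γ, hγ⟩ := isCusp_SL2Z_iff'.mp hc
  set h := (mapGL ℝ γ)⁻¹ * g with hh
  have hgh : g = mapGL ℝ γ * h := by rw [hh, mul_inv_cancel_left]
  have h10 : h 1 0 = 0 := by
    rw [← OnePoint.smul_infty_eq_self_iff, hh, mul_smul, hγ, inv_smul_smul]
  have hhd : 0 < h.det.val := by
    rw [hgh] at hg; simpa using hg
  rw [hgh, muAux_SL_mul]
  have e : muAux h = (12 * π * I : ℂ)⁻¹ • ((2 * π * I : ℂ) • (E2 ∣[(2 : ℤ)] h) -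
      (2 * π * I : ℂ) • E2) := by
    ext z
    have hσ : ∀ x, σ h x = x := by
      intro x; simp only [σ, hhd, if_true]; rfl
    rw [muAux, logD_slash mdiff_disc ModularForm.discriminant_ne_zero hhd, h10]
    simp only [ModularForm.slash_apply, hσ, logD_disc, Pi.smul_apply, Pi.sub_apply, smul_eq_mul]
    push_cast
    ring
  rw [e]
  have b1 : IsBoundedAtImInfty (E2 ∣[(2 : ℤ)] h) := isBoundedAtImInfty_E2.slash _ h10
  exact ((b1.const_smul_left _).sub (isBoundedAtImInfty_E2.const_smul_left _)).const_smul_left _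

lemma muFun_mem (α : GQ) : muFun α ∈ M 2 := by
  rw [muFun_eq, mem_M, isModular_iff]
  have hd := det_pos α
  refine ⟨mdiff_muAux hd, ?_, fun γ ↦ ?_⟩
  · obtain ⟨N', hN', h⟩ := exists_Gamma_le_conj (α : GL (Fin 2) ℚ) 1
    refine ⟨N', hN', fun γ hγ ↦ ?_⟩
    obtain ⟨δ, hδ, hδ'⟩ := h γ hγ
    have e : toGLReal α * mapGL ℝ γ = mapGL ℝ δ * toGLReal α := by
      have h' := congr_arg (Matrix.GeneralLinearGroup.map (Rat.castHom ℝ)) hδ'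
      rw [map_mul, map_mul, map_inv, map_mapGL', map_mapGL'] at h'
      exact (eq_mul_inv_iff_mul_eq.mp h').symm
    have := muAux_slash_SL hd γ
    rw [e, muAux_SL_mul] at this
    exact_mod_cast this
  · have := muAux_slash_SL hd γ
    push_cast
    rw [this]
    refine isBounded_muAux ?_ (isCusp_smul α γ)
    simpa using hd


/-- The graded algebra `𝓜 = ⨁ₖ 𝓜ₖ` of modular forms of all levels and weights. -/
abbrev MM : Type := ⨁ k : ℕ, M k

instance : CommRing MM := DirectSum.commRing fun k ↦ M k

/-- The slash operator `f ↦ f|ₖ α` on `𝓜ₖ`. -/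
def slashM (k : ℕ) (α : GQ) : M k →ₗ[ℂ] M k where
  toFun f := ⟨slash k α f, slash_mem α f.2⟩
  map_add' f g := Subtype.ext (slash_add k α f g)
  map_smul' c f := Subtype.ext (slash_smul k α c f)

lemma slash_one_fun (α : GQ) : slash 0 α 1 = 1 := by
  ext z; simp [slash]

/-- The slash operator on `𝓜`, acting on each homogeneous component through its weight. -/
def slashHom (α : GQ) : MM →+* MM :=
  DirectSum.toSemiring
    (fun k ↦ (DirectSum.of (fun k ↦ M k) k).comp (slashM k α).toAddMonoidHom)
    (by
      change DirectSum.of (fun k ↦ M k) 0 _ = 1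
      rw [DirectSum.one_def]
      congr 1
      exact Subtype.ext (slash_one_fun α))
    (by
      intro i j f g
      change DirectSum.of (fun k ↦ M k) (i + j) _ =
        DirectSum.of (fun k ↦ M k) i _ * DirectSum.of (fun k ↦ M k) j _
      rw [DirectSum.of_mul_of]
      congr 1
      exact Subtype.ext (slash_mul_slash i j α f g))

lemma slashHom_of (α : GQ) (k : ℕ) (f : M k) :
    slashHom α (DirectSum.of (fun k ↦ M k) k f) = DirectSum.of (fun k ↦ M k) k (slashM k α f) := by
  rw [slashHom, DirectSum.toSemiring_of]; rfl

/-- The right slash action as a left action of the opposite group: `op α • f = f|α`. -/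
instance : MulSemiringAction GQᵐᵒᵖ MM where
  smul α f := slashHom α.unop f
  one_smul f := by
    change slashHom 1 f = f
    induction f using DirectSum.induction_on with
    | zero => exact map_zero _
    | of k f => rw [slashHom_of]; congr 1; exact Subtype.ext (slash_one k f)
    | add f g hf hg => rw [map_add, hf, hg]
  mul_smul α β f := by
    change slashHom (β.unop * α.unop) f = slashHom α.unop (slashHom β.unop f)
    induction f using DirectSum.induction_on with
    | zero => simp
    | of k f => simp only [slashHom_of]; congr 1; exact Subtype.ext (slash_mul k _ _ f)
    | add f g hf hg => simp only [map_add, hf, hg]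
  smul_zero α := map_zero (slashHom α.unop)
  smul_add α := map_add (slashHom α.unop)
  smul_one α := map_one (slashHom α.unop)
  smul_mul α := map_mul (slashHom α.unop)

lemma op_smul_of (α : GQ) (k : ℕ) (f : M k) :
    MulOpposite.op α • (DirectSum.of (fun k ↦ M k) k f : MM) =
      DirectSum.of (fun k ↦ M k) k (slashM k α f) :=
  slashHom_of α k f

instance : SMulCommClass GQᵐᵒᵖ ℂ MM where
  smul_comm α c f := by
    change slashHom α.unop (c • f) = c • slashHom α.unop f
    induction f using DirectSum.induction_on with
    | zero => simp
    | of k f =>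
      rw [← DirectSum.lof_eq_of ℂ, ← map_smul, DirectSum.lof_eq_of, slashHom_of, map_smul,
        DirectSum.lof_eq_of, slashHom_of]
      exact map_smul (DirectSum.lof ℂ ℕ (fun k ↦ M k) k) c _
    | add f g hf hg => simp only [smul_add, map_add, hf, hg]

/-- The crossed product `𝓐 = 𝓜 ⋊ G⁺(ℚ)`: finite sums of symbols `f U_γ*`, where `f U_γ*` is
`SkewMonoidAlgebra.single (op γ) f`. -/
abbrev A : Type := SkewMonoidAlgebra MM GQᵐᵒᵖ

/-- The symbol `f U_γ*`. -/
def symb (f : MM) (γ : GQ) : A := SkewMonoidAlgebra.single (MulOpposite.op γ) f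

/-- The product rule of the crossed product: `f U_α* · g U_β* = (f · g|α) U_{βα}*`. -/
lemma symb_mul_symb (f g : MM) (α β : GQ) :
    symb f α * symb g β = symb (f * slashHom α g) (β * α) := by
  rw [symb, symb, SkewMonoidAlgebra.single_mul_single]; rfl

/-- The inclusion `𝓜ₖ ⊂ 𝓜 ⊂ 𝓐`, `f ↦ f U_1*`. -/
def ofForm (k : ℕ) (f : M k) : A := symb (DirectSum.of (fun k ↦ M k) k f) 1

/-- The linear endomorphism of `𝓐` with `f U_γ* ↦ φ_γ(f) U_γ*`. -/
def onCoeff (φ : GQ → Module.End ℂ MM) : Module.End ℂ A :=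
  (SkewMonoidAlgebra.coeffLinearEquiv (S := ℂ) (k := MM) (G := GQᵐᵒᵖ)).symm.toLinearMap ∘ₗ
    Finsupp.lsum ℂ (fun γ ↦ Finsupp.lsingle γ ∘ₗ φ γ.unop) ∘ₗ
    (SkewMonoidAlgebra.coeffLinearEquiv (S := ℂ) (k := MM) (G := GQᵐᵒᵖ)).toLinearMap

lemma onCoeff_symb (φ : GQ → Module.End ℂ MM) (f : MM) (γ : GQ) :
    onCoeff φ (symb f γ) = symb (φ γ f) γ := by
  have h : SkewMonoidAlgebra.coeffLinearEquiv (S := ℂ) (symb f γ) =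
      Finsupp.single (MulOpposite.op γ) f := rfl
  simp only [onCoeff, LinearMap.comp_apply, LinearEquiv.coe_coe, h, Finsupp.lsum_single,
    Finsupp.lsingle_apply, MulOpposite.unop_op]
  rfl

lemma mdiff_of_mem {k : ℕ} {f : ℍ → ℂ} (hf : f ∈ M k) : MDiff f :=
  ((isModular_iff k f).mp hf).1

/-- The operator `X : 𝓜ₖ → 𝓜ₖ₊₂`. -/
def XM (k : ℕ) : M k →ₗ[ℂ] M (k + 2) where
  toFun f := ⟨Xfun k f, Xfun_mem f.2⟩
  map_add' f g := Subtype.ext (by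
    simpa [Xfun_eq] using
      serreDerivative_add (k : ℂ) (f : ℍ → ℂ) g (mdiff_of_mem f.2) (mdiff_of_mem g.2))
  map_smul' c f := Subtype.ext (by
    simpa [Xfun_eq] using serreDerivative_smul (k : ℂ) c (f : ℍ → ℂ) (mdiff_of_mem f.2))

/-- The operator `X` on `𝓜`. -/
def XMM : Module.End ℂ MM :=
  DirectSum.toModule ℂ ℕ MM fun k ↦ DirectSum.lof ℂ ℕ (fun k ↦ M k) (k + 2) ∘ₗ XM k

/-- `μ_γ` as an element of `𝓜₂`. -/
def mu (γ : GQ) : M 2 := ⟨muFun γ, muFun_mem γ⟩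

/-- `X (f U_γ*) = X(f) U_γ*`. -/
def X : Module.End ℂ A := onCoeff fun _ ↦ XMM

/-- `δ₁ (f U_γ*) = μ_γ f U_γ*`. -/
def delta1 : Module.End ℂ A :=
  onCoeff fun γ ↦ LinearMap.mulLeft ℂ (DirectSum.of (fun k ↦ M k) 2 (mu γ) : MM)

/-- `δ₂ = [X, δ₁]`. -/
def delta2 : Module.End ℂ A := X * delta1 - delta1 * X

/-- The Schwarzian `δ₂' = δ₂ - ½ δ₁²`. -/
def delta2' : Module.End ℂ A := delta2 - (1 / 2 : ℂ) • delta1 ^ 2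

/-- The Eichler integral `Z(z) = (2πi/6) ∫_{i∞}^z η(w)⁴ dw`, taken along the vertical half-line
`w = z + it`, `t` from `∞` to `0`, so that `dw = i dt`. -/
def Z (z : ℂ) : ℂ :=
  2 * π * I / 6 * -(∫ t in Set.Ioi (0 : ℝ), ModularForm.eta (z + t * I) ^ 4 * I)

/-- The classical Schwarzian derivative
`{y; x} = (d/dx)² log (dy/dx) - ½ ((d/dx) log (dy/dx))²`. -/
def schwarzian (y : ℂ → ℂ) (x : ℂ) : ℂ :=
  deriv (logDeriv (deriv y)) x - 1 / 2 * logDeriv (deriv y) x ^ 2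

end ModHecke

end

/-! Since `d log Δ = 2πi E₂ dz`, the operator `X` is the Serre derivative, and `μ_γ` is one sixth of
`E₂|γ - E₂` corrected by a multiple of `r = c/(cz+d)`. As `X` is a derivation of `𝓜`, `δ₂'`
multiplies `f U_γ*` by `X(μ_γ) - μ_γ²/2`, whereas the commutator with `ω` multiplies it by `ω|γ -
ω`. So the claim is that a Schwarzian cocycle is a coboundary.

Put `φ = D E₂ - E₂²/12`. Because `r' = -r²`, the terms in `r` cancel and `X(μ_γ) - μ_γ²/2 = (φ|γ -
φ)/6` (`D_muAux_sub`). For `γ ∈ SL(2, ℤ)` one has `μ_γ = 0`, so `φ` is invariant of weight 4. Then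
`12 φ + E₄` is a level one cusp form of weight 4, hence zero, and `φ/6 = -E₄/72` (`schwarzE2_eq`).

Finally `Z' = (2πi/6) η⁴` has logarithmic derivative `(πi/3) E₂`, whence `{Z; z} = (2πi)² φ/6`. That
formula for `Z'` rests on differentiation under the integral sign (`hasDerivAt_integral_vertical`)
and the exponential decay of `η⁴`. -/

noncomputable section

namespace ModHecke

open Filter Topology MeasureTheory

/-! ### Vertical primitives of rapidly decreasing holomorphic functions -/

section VerticalIntegral

variable {F : ℂ → ℂ} {c : ℝ}

/-- Cauchy's estimate on the disc of radius `ε` about `w`, which lies above height `y`. -/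
lemma norm_deriv_le_of_exp_decay (hF : DifferentiableOn ℂ F upperHalfPlaneSet) (hc : 0 < c)
    {ε C : ℝ} (hε : 0 < ε) (hC : ∀ w : ℂ, ε ≤ w.im → ‖F w‖ ≤ C * Real.exp (-c * w.im)) {w : ℂ}
    {y : ℝ} (hy : ε ≤ y) (hw : y + ε ≤ w.im) : ‖deriv F w‖ ≤ C * Real.exp (-c * y) / ε := by
  have him : ∀ u ∈ Metric.closedBall w ε, y ≤ u.im := by
    intro u hu
    have h1 : |(u - w).im| ≤ ε :=
      (Complex.abs_im_le_norm _).trans (by simpa [dist_eq_norm] using hu)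
    have h2 := (abs_le.mp h1).1
    simp only [sub_im] at h2
    linarith
  -- The sign of `C` is forced by the bound at the point `εi`.
  have hC0 : 0 ≤ C := by
    have := (norm_nonneg _).trans (hC (ε * I) (by simp))
    exact nonneg_of_mul_nonneg_left this (Real.exp_pos _)
  refine Complex.norm_deriv_le_of_forall_mem_sphere_norm_le hε ?_ fun u hu ↦ ?_
  · refine DifferentiableOn.diffContOnCl ?_
    rw [closure_ball _ hε.ne']
    exact hF.mono fun u hu ↦ hε.trans_le (hy.trans (him u hu))
  · have hu' := him u (Metric.sphere_subset_closedBall hu)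
    refine (hC u (hy.trans hu')).trans ?_
    gcongr C * Real.exp ?_
    nlinarith

lemma continuousOn_vertical {G : ℂ → ℂ} (hG : ContinuousOn G upperHalfPlaneSet) {z : ℂ}
    (hz : 0 < z.im) : ContinuousOn (fun t : ℝ ↦ G (z + t * I)) (Set.Ici 0) := by
  refine hG.comp (by fun_prop) fun t ht ↦ ?_
  have : (0 : ℝ) ≤ t := ht
  change 0 < (z + t * I).im
  simp only [add_im, mul_im, ofReal_re, Complex.I_im, ofReal_im, Complex.I_re]
  linarith

lemma integrableOn_vertical (hF : DifferentiableOn ℂ F upperHalfPlaneSet) (hc : 0 < c)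
    (hdecay : ∀ ε > 0, ∃ C, ∀ w : ℂ, ε ≤ w.im → ‖F w‖ ≤ C * Real.exp (-c * w.im)) {z : ℂ}
    (hz : 0 < z.im) : IntegrableOn (fun t : ℝ ↦ F (z + t * I) * I) (Set.Ioi 0) := by
  obtain ⟨C, hC⟩ := hdecay z.im hz
  refine Integrable.mono' (g := fun t ↦ C * Real.exp (-c * z.im) * Real.exp (-c * t)) ?_ ?_ ?_
  · exact (integrableOn_exp_mul_Ioi (by linarith) 0).const_mul _
  · exact (((continuousOn_vertical hF.continuousOn hz).mul continuousOn_const).mono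
      Set.Ioi_subset_Ici_self).aestronglyMeasurable measurableSet_Ioi
  · refine (ae_restrict_iff' measurableSet_Ioi).mpr (.of_forall fun t ht ↦ ?_)
    have ht' : (0 : ℝ) < t := ht
    have := hC (z + t * I) (by simpa using ht'.le)
    simp only [add_im, mul_im, ofReal_re, Complex.I_im, mul_one, ofReal_im, Complex.I_re,
      mul_zero, add_zero] at this
    simpa [mul_assoc, ← Real.exp_add, mul_add] using this

/-- The integral of a rapidly decreasing holomorphic function from `z` to `i∞` along the vertical
half-line has derivative minus the function. -/
theorem hasDerivAt_integral_vertical (hF : DifferentiableOn ℂ F upperHalfPlaneSet) (hc : 0 < c)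
    (hdecay : ∀ ε > 0, ∃ C, ∀ w : ℂ, ε ≤ w.im → ‖F w‖ ≤ C * Real.exp (-c * w.im)) {z : ℂ}
    (hz : 0 < z.im) :
    HasDerivAt (fun w : ℂ ↦ ∫ t in Set.Ioi (0 : ℝ), F (w + t * I) * I) (-F z) z := by
  -- With this choice, points `w` of the disc of radius `2ε` about `z` have height above `2ε`, so `w
  -- + ti` is more than `ε` above the height `ε + t`: room for a Cauchy disc at every `t`, with a
  -- bound uniform in `w`.
  set ε := z.im / 4 with hε
  have hε0 : 0 < ε := by positivity
  obtain ⟨C, hC⟩ := hdecay ε hε0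
  have him : ∀ w ∈ Metric.ball z (2 * ε), 2 * ε < w.im := by
    intro w hw
    have h1 : |(w - z).im| < 2 * ε :=
      (Complex.abs_im_le_norm _).trans_lt (by simpa [dist_eq_norm] using hw)
    have h2 := (abs_lt.mp h1).1
    simp only [sub_im] at h2
    linarith
  have hFd : ∀ w : ℂ, 0 < w.im → HasDerivAt F (deriv F w) w := fun w hw ↦
    (hF.differentiableAt (isOpen_upperHalfPlaneSet.mem_nhds hw)).hasDerivAt
  have hcont := (hF.deriv isOpen_upperHalfPlaneSet).continuousOn
  have hmain := hasDerivAt_integral_of_dominated_loc_of_deriv_le (𝕜 := ℂ)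
    (μ := volume.restrict (Set.Ioi (0 : ℝ))) (x₀ := z) (F := fun w (t : ℝ) ↦ F (w + t * I) * I)
    (F' := fun w (t : ℝ) ↦ deriv F (w + t * I) * I)
    (bound := fun t ↦ C * Real.exp (-c * ε) / ε * Real.exp (-c * t))
    (Metric.ball_mem_nhds z (by positivity : 0 < 2 * ε)) ?_
    (integrableOn_vertical hF hc hdecay hz) ?_ ?_ ?_ ?_
  · obtain ⟨hint, hder⟩ := hmain
    -- The differentiated integrand `F'(z + ti) i` is the `t`-derivative of `F(z + ti)`, so its
    -- integral is the limit at infinity, zero, minus the value `F z` at `t = 0`.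
    have hlim : Tendsto (fun t : ℝ ↦ F (z + t * I)) atTop (𝓝 0) := by
      refine squeeze_zero_norm' (a := fun t : ℝ ↦ C * Real.exp (-c * (z.im + t))) ?_ ?_
      · filter_upwards [eventually_ge_atTop 0] with t ht
        simpa using hC (z + t * I) (by simp; linarith)
      · rw [show (0 : ℝ) = C * 0 by simp]
        refine (Real.tendsto_exp_atBot.comp ?_).const_mul _
        exact (tendsto_atTop_add_const_left _ _ tendsto_id).const_mul_atTop_of_neg (by linarith)
    have hFTC := integral_Ioi_of_hasDerivAt_of_tendsto' (a := (0 : ℝ))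
      (f := fun t : ℝ ↦ F (z + t * I)) (f' := fun t ↦ deriv F (z + t * I) * I) ?_ hint hlim
    · rw [hFTC] at hder
      simpa using hder
    · intro t ht
      have ht' : (0 : ℝ) ≤ t := ht
      have h1 : HasDerivAt (fun t : ℝ ↦ z + t * I) I t := by
        simpa using (((hasDerivAt_id t).ofReal_comp).mul_const I).const_add z
      exact (hFd (z + t * I) (by simp; linarith)).comp t h1
  · filter_upwards [isOpen_upperHalfPlaneSet.mem_nhds hz] with w hw
    exact (((continuousOn_vertical hF.continuousOn hw).mul continuousOn_const).mono
      Set.Ioi_subset_Ici_self).aestronglyMeasurable measurableSet_Ioi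
  · exact (((continuousOn_vertical hcont hz).mul continuousOn_const).mono
      Set.Ioi_subset_Ici_self).aestronglyMeasurable measurableSet_Ioi
  · refine (ae_restrict_iff' measurableSet_Ioi).mpr (.of_forall fun t ht w hw ↦ ?_)
    have ht' : (0 : ℝ) < t := ht
    have := norm_deriv_le_of_exp_decay hF hc hε0 hC (w := w + t * I) (y := ε + t) (by linarith)
      (by simp; linarith [him w hw])
    rw [norm_mul, norm_I, mul_one]
    refine this.trans_eq ?_
    rw [mul_add, Real.exp_add]
    ring
  · exact (integrableOn_exp_mul_Ioi (by linarith) 0).const_mul _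
  · refine (ae_restrict_iff' measurableSet_Ioi).mpr (.of_forall fun t ht w hw ↦ ?_)
    have ht' : (0 : ℝ) < t := ht
    have h1 : HasDerivAt (fun w : ℂ ↦ w + t * I) 1 w := (hasDerivAt_id w).add_const _
    simpa using ((hFd (w + t * I) (by simp; linarith [him w hw])).comp w h1).mul_const I

end VerticalIntegral

/-! ### The Eichler integral of `η⁴` -/

/-- The sixth power of `η⁴` is `Δ`, which decays like `exp(-2πy)`; the rate `π/3` is a sixth of
`2π`. High up this is the decay at the cusp; between heights `ε` and `A` the bound `|Δ| ≤ C₂ y⁻⁶`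
suffices. -/
lemma exists_norm_eta_pow_four_le {ε : ℝ} (hε : 0 < ε) :
    ∃ C, ∀ w : ℂ, ε ≤ w.im → ‖ModularForm.eta w ^ 4‖ ≤ C * Real.exp (-(π / 3) * w.im) := by
  obtain ⟨C₁, hC₁⟩ := (CuspFormClass.exp_decay_atImInfty (h := 1) CuspForm.discriminant one_pos
    one_mem_strictPeriods_SL).bound
  obtain ⟨A, hA⟩ := (atImInfty_mem _).mp hC₁
  obtain ⟨C₂, hC₂⟩ := CuspFormClass.exists_bound CuspForm.discriminant
  have hC₂0 : 0 ≤ C₂ := by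
    have := (norm_nonneg _).trans (hC₂ UpperHalfPlane.I)
    simpa using this
  -- The factor `exp(2πA)` pays for the exponential below height `A`, and `K ≥ 1` gives `K ≤ K⁶`
  -- when sixth roots are taken.
  set K := max 1 (max C₁ (C₂ / ε ^ 6 * Real.exp (2 * π * A))) with hK
  have hK1 : 1 ≤ K := le_max_left _ _
  refine ⟨K, fun w hw ↦ ?_⟩
  have hw0 : 0 < w.im := hε.trans_le hw
  have hΔ : ‖ModularForm.eta w ^ 24‖ ≤ K * Real.exp (-2 * π * w.im) := by
    rcases le_total A w.im with h | h
    · have h1 := hA ⟨w, hw0⟩ h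
      simp only [Set.mem_ofPred_eq, CuspForm.coe_discriminant, ModularForm.discriminant,
        div_one, Real.norm_eq_abs, Real.abs_exp] at h1
      refine h1.trans ?_
      gcongr ?_ * _
      exact (le_max_left _ _).trans (le_max_right _ _)
    · have h1 := hC₂ ⟨w, hw0⟩
      have h2 : w.im ^ (((12 : ℤ) : ℝ) / 2) = w.im ^ 6 := by
        rw [← Real.rpow_natCast]; norm_num
      simp only [CuspForm.coe_discriminant, ModularForm.discriminant] at h1
      change _ ≤ C₂ / w.im ^ (((12 : ℤ) : ℝ) / 2) at h1
      rw [h2] at h1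
      calc _ ≤ C₂ / w.im ^ 6 := h1
        _ ≤ C₂ / ε ^ 6 * 1 := by rw [mul_one]; gcongr
        _ ≤ C₂ / ε ^ 6 * (Real.exp (2 * π * A) * Real.exp (-2 * π * w.im)) := by
          gcongr
          rw [← Real.exp_add, Real.one_le_exp_iff]
          nlinarith [Real.pi_pos]
        _ = C₂ / ε ^ 6 * Real.exp (2 * π * A) * Real.exp (-2 * π * w.im) := by ring
        _ ≤ K * Real.exp (-2 * π * w.im) := by
          gcongr
          exact (le_max_right _ _).trans (le_max_right _ _)
  rw [← pow_le_pow_iff_left₀ (norm_nonneg _) (by positivity) (by norm_num : 6 ≠ 0), ← norm_pow,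
    ← pow_mul, mul_pow, ← Real.exp_nat_mul]
  refine hΔ.trans ?_
  rw [show ((6 : ℕ) : ℝ) * (-(π / 3) * w.im) = -2 * π * w.im by push_cast; ring]
  gcongr
  exact le_self_pow₀ hK1 (by norm_num)

lemma differentiableOn_eta_pow_four :
    DifferentiableOn ℂ (fun w ↦ ModularForm.eta w ^ 4) upperHalfPlaneSet := fun _ hw ↦
  ((ModularForm.differentiableAt_eta_of_mem_upperHalfPlaneSet hw).pow 4).differentiableWithinAt

lemma integrableOn_eta_pow_four (z : ℍ) :
    IntegrableOn (fun t : ℝ ↦ ModularForm.eta (z + t * I) ^ 4 * I) (Set.Ioi 0) :=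
  integrableOn_vertical differentiableOn_eta_pow_four (by positivity : 0 < π / 3)
    (fun _ ↦ exists_norm_eta_pow_four_le) z.im_pos

lemma hasDerivAt_Z (z : ℍ) : HasDerivAt Z (2 * π * I / 6 * ModularForm.eta z ^ 4) z := by
  have h := hasDerivAt_integral_vertical differentiableOn_eta_pow_four
    (by positivity : 0 < π / 3) (fun _ ↦ exists_norm_eta_pow_four_le) z.im_pos
  exact (h.neg.const_mul (2 * π * I / 6)).congr_deriv (by ring)

end ModHecke

end

noncomputable section

namespace ModHecke

open Filter Topology Derivative EisensteinSeries

/-! ### The quasimodular Schwarzian `D E₂ - E₂² / 12` -/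

/-- The form `D E₂ - E₂² / 12`. -/
def schwarzE2 : ℍ → ℂ := serreDerivative 1 E2

/-- The Serre derivative is taken with parameter 1 although `E₂` has weight 2: the parameter 1 is
what yields the coefficient `1/12`. -/
lemma schwarzE2_apply (z : ℍ) : schwarzE2 z = D E2 z - E2 z ^ 2 / 12 := by
  simp only [schwarzE2, serreDerivative_apply]
  ring

lemma muAux_eq {g : GL (Fin 2) ℝ} (hg : 0 < g.det.val) (z : ℍ) :
    muAux g z = 6⁻¹ * ((E2 ∣[(2 : ℤ)] g) z - 12 * (2 * π * I)⁻¹ * (g 1 0 / denom g z) - E2 z) := by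
  have hσ : ∀ x, σ g x = x := by
    intro x; simp only [σ, hg, if_true]; rfl
  have hpi : (π : ℂ) ≠ 0 := by exact_mod_cast Real.pi_ne_zero
  rw [muAux, logD_slash mdiff_disc ModularForm.discriminant_ne_zero hg]
  simp only [ModularForm.slash_apply, hσ, logD_disc]
  push_cast
  field_simp
  ring

/-- The Riccati equation `r' = -r²` for `r = c/(cz+d)`; it makes the quadratic terms cancel in the
cocycle identity. -/
lemma D_const_div_denom (g : GL (Fin 2) ℝ) (z : ℍ) :
    D (fun w : ℍ ↦ (g 1 0 : ℂ) / denom g w) z = -(2 * π * I)⁻¹ * (g 1 0 / denom g z) ^ 2 := by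
  have hz := denom_ne_zero g z
  have h1 := (hasDerivAt_denom_zpow g (-1) z).const_mul (g 1 0 : ℂ)
  have h2 : (fun w : ℍ ↦ (g 1 0 : ℂ) / denom g w) ∘ ofComplex =ᶠ[𝓝 (z : ℂ)]
      fun w ↦ (g 1 0 : ℂ) * denom g w ^ (-1 : ℤ) := by
    filter_upwards [isOpen_upperHalfPlaneSet.mem_nhds z.im_pos] with w hw
    simp [ofComplex_apply_of_im_pos hw, div_eq_mul_inv]
  rw [normalizedDerivOfComplex, (h1.congr_of_eventuallyEq h2).deriv]
  rw [show (-1 - 1 : ℤ) = -((2 : ℕ) : ℤ) by norm_num, zpow_neg, zpow_natCast]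
  push_cast
  field_simp

lemma mdiff_const_div_denom (g : GL (Fin 2) ℝ) :
    MDiff (fun w : ℍ ↦ (g 1 0 : ℂ) / denom g w) := by
  intro z
  rw [UpperHalfPlane.mdifferentiableAt_iff]
  have h1 := (hasDerivAt_denom_zpow g (-1) z).const_mul (g 1 0 : ℂ)
  refine (h1.congr_of_eventuallyEq ?_).differentiableAt
  filter_upwards [isOpen_upperHalfPlaneSet.mem_nhds z.im_pos] with w hw
  simp [ofComplex_apply_of_im_pos hw, div_eq_mul_inv]

/-- The Schwarzian cocycle identity: `X(μ_g) - μ_g² / 2` is the coboundary of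
`(D E₂ - E₂² / 12) / 6`. -/
lemma D_muAux_sub {g : GL (Fin 2) ℝ} (hg : 0 < g.det.val) (z : ℍ) :
    D (muAux g) z - 6⁻¹ * E2 z * muAux g z - 2⁻¹ * muAux g z ^ 2 =
      6⁻¹ * ((g.det.val : ℂ)⁻¹ * (schwarzE2 ∣[(4 : ℤ)] g) z - schwarzE2 z) := by
  have hσ : ∀ x, σ g x = x := by
    intro x; simp only [σ, hg, if_true]; rfl
  have hpi : (π : ℂ) ≠ 0 := by exact_mod_cast Real.pi_ne_zero
  have hd : (g.det.val : ℂ) ≠ 0 := by exact_mod_cast hg.ne'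
  have hE := E2_mdifferentiable
  have hEg : MDiff (E2 ∣[(2 : ℤ)] g) := hE.slash _ _
  have hden := mdiff_const_div_denom g
  have hmu : muAux g = (6⁻¹ : ℂ) • ((E2 ∣[(2 : ℤ)] g) -
      (12 * (2 * π * I)⁻¹ : ℂ) • (fun w : ℍ ↦ (g 1 0 : ℂ) / denom g w) - E2) := by
    ext w; simp [muAux_eq hg w]
  have hD : D (muAux g) z = 6⁻¹ * (D (E2 ∣[(2 : ℤ)] g) z +
      12 * (2 * π * I)⁻¹ * (2 * π * I)⁻¹ * (g 1 0 / denom g z) ^ 2 - D E2 z) := by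
    rw [hmu, normalizedDerivOfComplex_smul _ _ ((hEg.sub (hden.const_smul _)).sub hE),
      normalizedDerivOfComplex_sub _ _ (hEg.sub (hden.const_smul _)) hE,
      normalizedDerivOfComplex_sub _ _ hEg (hden.const_smul _),
      normalizedDerivOfComplex_smul _ _ hden]
    simp only [Pi.smul_apply, Pi.sub_apply, D_const_div_denom, smul_eq_mul]
    ring
  have hslash := congrFun (normalizedDerivOfComplex_slash (k := 2) hE (g := g) hg) z
  have hd' : g.val.det = g.det.val := rfl
  rw [hd'] at hslash
  -- The weight `k` slash carries `det^(k-1)`, so it is not multiplicative: slashing `E₂²` in weight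
  -- 4 gives `det³`, squaring `E₂|g` only `det²`.
  have hS : (schwarzE2 ∣[(4 : ℤ)] g) z =
      (D E2 ∣[(4 : ℤ)] g) z - g.det.val * (E2 ∣[(2 : ℤ)] g) z ^ 2 / 12 := by
    simp only [ModularForm.slash_apply, hσ, schwarzE2_apply, abs_of_pos hg]
    rw [show (4 - 1 : ℤ) = (3 : ℕ) by norm_num, show (2 - 1 : ℤ) = (1 : ℕ) by norm_num,
      show (-4 : ℤ) = -(4 : ℕ) by norm_num, show (-2 : ℤ) = -(2 : ℕ) by norm_num]
    simp only [zpow_neg, zpow_natCast]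
    have := denom_ne_zero g z
    field_simp
  rw [hD, hslash, hS, muAux_eq hg, schwarzE2_apply]
  rw [show (2 + 2 : ℤ) = 4 by norm_num]
  push_cast
  field_simp
  ring

/-- By the cocycle identity: its left side vanishes because `μ_γ = 0` on `SL(2, ℤ)`. -/
lemma schwarzE2_slash_SL (γ : SL(2, ℤ)) : schwarzE2 ∣[(4 : ℤ)] (mapGL ℝ γ) = schwarzE2 := by
  ext z
  have h := D_muAux_sub (det_mapGL_pos γ) z
  have h0 : D (0 : ℍ → ℂ) z = 0 := congrFun (normalizedDerivOfComplex_const 0) z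
  rw [muAux_SL, h0] at h
  simp only [Pi.zero_apply] at h
  have hd : ((mapGL ℝ γ).det.val : ℂ) = 1 := by simp
  rw [hd] at h
  linear_combination -6 * h

/-! ### Behaviour at `i∞` and Ramanujan's identity -/

lemma isZero_D {f : ℍ → ℂ} (hf : MDiff f) (hb : IsZeroAtImInfty f) : IsZeroAtImInfty (D f) := by
  rw [isZeroAtImInfty_iff] at hb ⊢
  intro ε hε
  obtain ⟨A, h⟩ := hb ε hε
  refine ⟨max A 0 + 1, fun z hz ↦ ?_⟩
  have him : ∀ w ∈ Metric.closedBall (z : ℂ) (1 / 2), max A 0 < w.im := by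
    intro w hw
    have h1 : |(w - z).im| ≤ 1 / 2 :=
      (Complex.abs_im_le_norm _).trans (by simpa [dist_eq_norm] using hw)
    have h2 := (abs_le.mp h1).1
    simp only [sub_im, coe_im] at h2
    linarith
  have hder : ‖deriv (f ∘ ofComplex) z‖ ≤ ε / (1 / 2) := by
    refine Complex.norm_deriv_le_of_forall_mem_sphere_norm_le (by norm_num) ?_ ?_
    · refine DifferentiableOn.diffContOnCl ?_
      rw [closure_ball _ (by norm_num)]
      exact (UpperHalfPlane.mdifferentiable_iff.mp hf).mono
        fun w hw ↦ (le_max_right A 0).trans_lt (him w hw)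
    · intro w hw
      have hw' := him w (Metric.sphere_subset_closedBall hw)
      have hpos : 0 < w.im := (le_max_right A 0).trans_lt hw'
      rw [Function.comp_apply, ofComplex_apply_of_im_pos hpos]
      exact h _ ((le_max_left A 0).trans hw'.le)
  -- This absorbs the factor 2 lost in Cauchy's estimate with radius `1/2`, so the same `ε` is
  -- recovered.
  have hn : ‖(2 * π * I : ℂ)⁻¹‖ ≤ 1 / 2 := by
    rw [norm_inv, norm_mul, norm_mul, norm_I, mul_one, Complex.norm_ofNat, Complex.norm_real,
      Real.norm_of_nonneg Real.pi_pos.le, one_div]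
    gcongr
    linarith [Real.pi_gt_three]
  rw [normalizedDerivOfComplex, norm_mul]
  calc _ ≤ 1 / 2 * (ε / (1 / 2)) := by gcongr
    _ = ε := by ring

/-- Removing the constant term and dividing by `q` leaves another convergent `q`-series, which is
bounded at `i∞`; hence `f - c 0 = O(q)`. -/
lemma tendsto_of_hasSum_qExpansion {f : ℍ → ℂ} {c : ℕ → ℂ}
    (hf : ∀ τ : ℍ, HasSum (fun m ↦ c m • Function.Periodic.qParam 1 τ ^ m) (f τ)) :
    Tendsto f atImInfty (𝓝 (c 0)) := by
  have hq : ∀ τ : ℍ, Function.Periodic.qParam 1 τ ≠ 0 := fun τ ↦ Complex.exp_ne_zero _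
  have hb : IsBoundedAtImInfty fun τ ↦ (f τ - c 0) / Function.Periodic.qParam 1 τ := by
    refine isBoundedAtImInfty_of_hasSum_qExpansion (c := fun m ↦ c (m + 1)) one_pos fun τ ↦ ?_
    have h := ((hasSum_nat_add_iff' 1).mpr (hf τ)).div_const (Function.Periodic.qParam 1 τ)
    simp only [Finset.range_one, Finset.sum_singleton, pow_zero, smul_eq_mul, mul_one] at h
    refine h.congr_fun fun m ↦ ?_
    have := hq τ
    rw [smul_eq_mul, pow_succ, ← mul_assoc, mul_div_cancel_right₀ _ this]
  have h0 : Tendsto (fun τ ↦ f τ - c 0) atImInfty (𝓝 0) := by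
    have hq0 : Tendsto (fun τ : ℍ ↦ (1 : ℍ → ℝ) τ • Function.Periodic.qParam 1 τ) atImInfty
        (𝓝 0) := by
      simpa using qParam_tendsto_atImInfty one_pos
    have := (Asymptotics.IsBigO.smul hb (Asymptotics.isBigO_refl
      (fun τ : ℍ ↦ Function.Periodic.qParam 1 τ) atImInfty)).trans_tendsto hq0
    exact this.congr fun τ ↦ div_mul_cancel₀ _ (hq τ)
  simpa using h0.add_const (c 0)

lemma tendsto_E2 : Tendsto E2 atImInfty (𝓝 1) := by
  have h := tendsto_of_hasSum_qExpansion (f := E2) fun τ ↦ by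
    simpa only [Function.Periodic.qParam, ofReal_one, div_one] using hasSum_qExpansion_E2 (z := τ)
  rwa [if_pos rfl] at h

lemma tendsto_E₄ : Tendsto ModularForm.E₄ atImInfty (𝓝 1) := by
  have h := tendsto_of_hasSum_qExpansion fun τ ↦
    ModularForm.hasSum_qExpansion ModularForm.E₄ one_pos one_mem_strictPeriods_SL τ
  rwa [EisensteinSeries.E_qExpansion_coeff_zero _ ⟨2, rfl⟩] at h

lemma tendsto_schwarzE2 : Tendsto schwarzE2 atImInfty (𝓝 (-1 / 12)) := by
  have h1 : IsZeroAtImInfty (E2 - fun _ ↦ 1) := by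
    have := tendsto_E2.sub_const 1
    rwa [sub_self] at this
  have h2 := isZero_D (E2_mdifferentiable.sub mdifferentiable_const) h1
  rw [normalizedDerivOfComplex_sub _ _ E2_mdifferentiable mdifferentiable_const,
    normalizedDerivOfComplex_const, sub_zero] at h2
  have h3 := Tendsto.sub h2 ((tendsto_E2.pow 2).div_const 12)
  refine (h3.congr fun z ↦ (schwarzE2_apply z).symm).trans_eq ?_
  norm_num

lemma E₄_slash_SL (γ : SL(2, ℤ)) :
    ⇑ModularForm.E₄ ∣[(4 : ℤ)] (mapGL ℝ γ) = ModularForm.E₄ :=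
  ModularForm.E₄.slash_action_eq' (mapGL ℝ γ) ⟨γ, rfl⟩

/-- The cusp form `12 (D E₂ - E₂² / 12) + E₄`. -/
def ramanujanCuspForm : CuspForm 𝒮ℒ 4 :=
  have hslash (γ : SL(2, ℤ)) : ((12 : ℂ) • schwarzE2 + ⇑ModularForm.E₄) ∣[(4 : ℤ)] (mapGL ℝ γ) =
      (12 : ℂ) • schwarzE2 + ⇑ModularForm.E₄ := by
    have hσ : σ (mapGL ℝ γ) 12 = 12 := by
      simp only [σ, det_mapGL_pos γ, if_true]; rfl
    rw [SlashAction.add_slash, ModularForm.smul_slash, hσ, schwarzE2_slash_SL, E₄_slash_SL]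
  { toFun := (12 : ℂ) • schwarzE2 + ⇑ModularForm.E₄
    slash_action_eq' := by
      rintro _ ⟨γ, rfl⟩
      exact hslash γ
    holo' := ((serreDerivative_mdifferentiable 1 E2_mdifferentiable).const_smul _).add
      ModularForm.E₄.holo'
    zero_at_cusps' := by
      intro c hc
      rw [Subgroup.IsArithmetic.isCusp_iff_isCusp_SL2Z] at hc
      rw [OnePoint.isZeroAt_iff_forall_SL2Z hc]
      intro γ _
      rw [ModularForm.SL_slash]
      -- By invariance under `SL(2, ℤ)` every cusp reduces to `i∞`, where the constant terms `12 ·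
      -- (-1/12)` and `1` cancel.
      refine Eq.mpr (congrArg _ (hslash γ)) ?_
      have h := (tendsto_schwarzE2.const_smul (12 : ℂ)).add tendsto_E₄
      rwa [show (12 : ℂ) • (-1 / 12 : ℂ) + 1 = 0 by norm_num] at h }

/-- Ramanujan's identity `D E₂ = (E₂² - E₄) / 12`. -/
theorem schwarzE2_eq (z : ℍ) : schwarzE2 z = -ModularForm.E₄ z / 12 := by
  have h := rank_zero_iff_forall_zero.mp
    (CuspForm.rank_eq_zero_of_weight_lt_twelve (by norm_num : (4 : ℤ) < 12)) ramanujanCuspForm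
  have h' : 12 * schwarzE2 z + ModularForm.E₄ z = 0 := DFunLike.congr_fun h z
  linear_combination h' / 12

/-! ### The Schwarzian of the Eichler integral -/

lemma deriv_Z_eventuallyEq (z : ℍ) :
    deriv Z =ᶠ[𝓝 (z : ℂ)] fun w ↦ 2 * π * I / 6 * ModularForm.eta w ^ 4 := by
  filter_upwards [isOpen_upperHalfPlaneSet.mem_nhds z.im_pos] with w hw
  exact (hasDerivAt_Z ⟨w, hw⟩).deriv

lemma logDeriv_deriv_Z (z : ℍ) : logDeriv (deriv Z) z = π * I / 3 * E2 z := by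
  have h := deriv_Z_eventuallyEq z
  have h1 : logDeriv (deriv Z) z =
      logDeriv (fun w ↦ 2 * π * I / 6 * ModularForm.eta w ^ 4) z := by
    simp only [logDeriv_apply, h.deriv_eq, h.eq_of_nhds]
  have h6 : (2 * π * I / 6 : ℂ) ≠ 0 := div_ne_zero Complex.two_pi_I_ne_zero (by norm_num)
  rw [h1, logDeriv_const_mul _ _ h6,
    logDeriv_fun_pow (ModularForm.differentiableAt_eta_of_mem_upperHalfPlaneSet z.2),
    ModularForm.logDeriv_eta_eq_E2]
  push_cast; ring

lemma schwarzian_Z (z : ℍ) : schwarzian Z z = (2 * π * I) ^ 2 / 6 * schwarzE2 z := by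
  have h : logDeriv (deriv Z) =ᶠ[𝓝 (z : ℂ)] fun w ↦ π * I / 3 * (E2 ∘ ofComplex) w := by
    filter_upwards [isOpen_upperHalfPlaneSet.mem_nhds z.im_pos] with w hw
    rw [Function.comp_apply, ofComplex_apply_of_im_pos hw]
    exact logDeriv_deriv_Z ⟨w, hw⟩
  have hd := UpperHalfPlane.mdifferentiableAt_iff.mp (E2_mdifferentiable z)
  have hpi : (π : ℂ) ≠ 0 := by exact_mod_cast Real.pi_ne_zero
  rw [schwarzian, h.deriv_eq, deriv_const_mul _ hd, logDeriv_deriv_Z, schwarzE2_apply,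
    normalizedDerivOfComplex]
  field_simp
  ring

end ModHecke

end

noncomputable section

namespace ModHecke

open Derivative EisensteinSeries

/-! ### The Schwarzian derivation on the crossed product -/

/-- Transports between components whose weights are equal but not definitionally so, such as `i + 2
+ j` and `i + j + 2` in the Leibniz rule. -/
lemma of_eq_of {i j : ℕ} (h : i = j) {f : M i} {g : M j} (hfg : (f : ℍ → ℂ) = g) :
    (DirectSum.of (fun k ↦ M k) i f : MM) = DirectSum.of (fun k ↦ M k) j g := by
  subst h
  rw [Subtype.ext hfg]

lemma XMM_of (k : ℕ) (f : M k) :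
    XMM (DirectSum.of (fun k ↦ M k) k f) = DirectSum.of (fun k ↦ M k) (k + 2) (XM k f) := by
  rw [XMM, ← DirectSum.lof_eq_of ℂ, DirectSum.toModule_lof]
  rfl

/-- The `E₂` term is linear in the weight, and weights add under products, so the Leibniz rule
survives the correction. -/
lemma Xfun_mul {k l : ℕ} {f g : ℍ → ℂ} (hf : MDiff f) (hg : MDiff g) :
    Xfun (k + l) (f * g) = Xfun k f * g + f * Xfun l g := by
  have h := serreDerivative_mul (k : ℂ) (l : ℂ) f g hf hg
  rw [Xfun_eq, Xfun_eq, Xfun_eq, Int.cast_natCast, Int.cast_natCast, Int.cast_natCast,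
    Nat.cast_add, h]

/-- `X` is a derivation of `𝓜`. -/
lemma XMM_mul (f g : MM) : XMM (f * g) = XMM f * g + f * XMM g := by
  induction f using DirectSum.induction_on with
  | zero => simp
  | add f₁ f₂ h₁ h₂ => simp only [add_mul, map_add, h₁, h₂]; abel
  | of i f =>
    induction g using DirectSum.induction_on with
    | zero => simp
    | add g₁ g₂ h₁ h₂ => simp only [mul_add, map_add, h₁, h₂]; abel
    | of j g =>
      rw [DirectSum.of_mul_of, XMM_of, XMM_of, XMM_of, DirectSum.of_mul_of, DirectSum.of_mul_of]
      have h : i + 2 + j = i + j + 2 := by ring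
      rw [of_eq_of h (g := ⟨_, h ▸ SetLike.mul_mem_graded (XM i f).2 g.2⟩) rfl]
      refine Eq.trans ?_ (map_add (DirectSum.of (fun k ↦ M k) (i + j + 2)) _ _)
      congr 1
      exact Subtype.ext (Xfun_mul (mdiff_of_mem f.2) (mdiff_of_mem g.2))

lemma E₄_mem : ⇑ModularForm.E₄ ∈ M 4 := by
  rw [mem_M, isModular_iff]
  refine ⟨ModularForm.E₄.holo', ⟨1, one_ne_zero, fun γ _ ↦ E₄_slash_SL γ⟩, fun γ ↦ ?_⟩
  refine Eq.mpr (congrArg _ (E₄_slash_SL γ)) ?_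
  exact tendsto_E₄.isBigO_one ℝ

/-- `ω₄ = -E₄ / 72` as an element of `𝓜₄`. -/
def omega4 : M 4 := (-1 / 72 : ℂ) • ⟨ModularForm.E₄, E₄_mem⟩

lemma omega4_apply (z : ℍ) : (omega4 : ℍ → ℂ) z = -ModularForm.E₄ z / 72 := by
  change (-1 / 72 : ℂ) * ModularForm.E₄ z = _
  ring

/-- Ramanujan's identity ties the explicit `-E₄/72` to the form that appears in the coboundary. -/
lemma omega4_eq : (omega4 : ℍ → ℂ) = (6⁻¹ : ℂ) • schwarzE2 := by
  ext z
  rw [omega4_apply, Pi.smul_apply, schwarzE2_eq, smul_eq_mul]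
  ring

lemma Xfun_muFun_sub (γ : GQ) :
    Xfun 2 (muFun γ) - (1 / 2 : ℂ) • (muFun γ * muFun γ) = slash 4 γ omega4 - omega4 := by
  ext z
  have h := D_muAux_sub (det_pos γ) z
  -- Passing to the normalisation `det^(k/2)` costs `det^(1 - k/2) = det⁻¹` for `k = 4`, exactly the
  -- factor in `D_muAux_sub`.
  have hr : ((toGLReal γ).det.val ^ (1 - ((4 : ℕ) : ℝ) / 2) : ℝ) = (toGLReal γ).det.val⁻¹ := by
    rw [← Real.rpow_neg_one]; norm_num
  rw [omega4_eq, slash_smul, slash_eq, hr, Xfun_eq, muFun_eq]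
  simp only [Pi.sub_apply, Pi.smul_apply, Pi.mul_apply, smul_eq_mul, serreDerivative_apply]
  push_cast
  linear_combination h

lemma XMM_mu_sub (γ : GQ) :
    XMM (DirectSum.of (fun k ↦ M k) 2 (mu γ)) - (1 / 2 : ℂ) •
      (DirectSum.of (fun k ↦ M k) 2 (mu γ) * DirectSum.of (fun k ↦ M k) 2 (mu γ) : MM) =
    slashHom γ (DirectSum.of (fun k ↦ M k) 4 omega4) - DirectSum.of (fun k ↦ M k) 4 omega4 := by
  rw [XMM_of, DirectSum.of_mul_of, slashHom_of, ← map_sub, ← DirectSum.lof_eq_of ℂ,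
    ← DirectSum.lof_eq_of ℂ, ← DirectSum.lof_eq_of ℂ, ← map_smul, ← map_sub]
  congr 1
  exact Subtype.ext (Xfun_muFun_sub γ)

lemma symb_sub (f g : MM) (γ : GQ) : symb (f - g) γ = symb f γ - symb g γ := by
  rw [eq_sub_iff_add_eq, symb, symb, symb, ← SkewMonoidAlgebra.single_add, sub_add_cancel]

lemma symb_smul (c : ℂ) (f : MM) (γ : GQ) : symb (c • f) γ = c • symb f γ :=
  (SkewMonoidAlgebra.smul_single _ _ _).symm

/-- On the coefficient of `U_γ*`, `X(μ f) - μ X(f) = X(μ) f` and `δ₁²` is multiplication by `μ²`, so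
the coboundary formula `XMM_mu_sub` applies; `𝓜` being commutative, the factors can be reordered. -/
lemma delta2'_symb (f : MM) (γ : GQ) :
    delta2' (symb f γ) = symb (f * slashHom γ (DirectSum.of (fun k ↦ M k) 4 omega4) -
      DirectSum.of (fun k ↦ M k) 4 omega4 * f) γ := by
  simp only [delta2', delta2, X, delta1, LinearMap.sub_apply, LinearMap.smul_apply,
    Module.End.mul_apply, pow_two, onCoeff_symb, LinearMap.mulLeft_apply, XMM_mul]
  rw [← symb_smul, ← symb_sub, ← symb_sub]
  congr 1
  rw [mul_comm f, ← sub_mul, ← XMM_mu_sub, sub_mul, smul_mul_assoc, mul_assoc, add_sub_cancel_right]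

/-- `δ₂'` is the inner derivation `[·, ω₄]`. -/
theorem delta2'_eq_commutator (a : A) :
    delta2' a = a * ofForm 4 omega4 - ofForm 4 omega4 * a := by
  induction a using SkewMonoidAlgebra.induction_on with
  | zero => simp
  | add a b ha hb => rw [map_add, ha, hb]; noncomm_ring
  | single γ f =>
    change delta2' (symb f γ.unop) = symb f γ.unop * symb _ 1 - symb _ 1 * symb f γ.unop
    rw [delta2'_symb, symb_mul_symb, symb_mul_symb, one_mul, mul_one, symb_sub]
    congr 3
    -- Multiplying by `ω₄ U_1*` on the left slashes `f` by the identity only.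
    exact (one_smul GQᵐᵒᵖ f).symm

end ModHecke

end

/-! ### The main theorem -/

theorem mainTheorem4 :
    ∃ ω₄ : ModHecke.M 4,
      (∀ z : ℍ, MeasureTheory.IntegrableOn
        (fun t : ℝ ↦ ModularForm.eta (z + t * I) ^ 4 * I) (Set.Ioi 0)) ∧
      (∀ z : ℍ, HasDerivAt ModHecke.Z (2 * π * I / 6 * ModularForm.eta z ^ 4) z) ∧
      (∀ z : ℍ, (ω₄ : ℍ → ℂ) z = ((2 * π * I : ℂ) ^ 2)⁻¹ * ModHecke.schwarzian ModHecke.Z z) ∧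
      (∀ z : ℍ, (ω₄ : ℍ → ℂ) z = -ModularForm.E₄ z / 72) ∧
      (∀ a b : ModHecke.A,
        ModHecke.delta2' (a * b) = ModHecke.delta2' a * b + a * ModHecke.delta2' b) ∧
      ∀ a : ModHecke.A,
        ModHecke.delta2' a = a * ModHecke.ofForm 4 ω₄ - ModHecke.ofForm 4 ω₄ * a := by
  refine ⟨ModHecke.omega4, ModHecke.integrableOn_eta_pow_four, ModHecke.hasDerivAt_Z,
    fun z ↦ ?_, ModHecke.omega4_apply, fun a b ↦ ?_, ModHecke.delta2'_eq_commutator⟩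
  · have h := Complex.two_pi_I_ne_zero
    rw [ModHecke.schwarzian_Z, ModHecke.omega4_eq, Pi.smul_apply, smul_eq_mul]
    field_simp
  -- The Leibniz rule is inherited from the commutator formula.
  · simp only [ModHecke.delta2'_eq_commutator]
    simp only [sub_mul, mul_sub, mul_assoc]
    abel
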